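/- **Theorem (Indirect Matching).** *Model.* On a probability space, for each $n$ let $\boldsymbol\alpha_i=\boldsymbol\alpha_{i}^{(n)}$, $1\le i\le n$, be random vectors in $\mathbb R^r$ ($r\ge1$ fixed), let $\eta_l=\eta_l^{(n)}:\mathbb R^r\to\mathbb R$, $1\le l\le p=p_n$, be random functions, and let $u_{il}=u_{il}^{(n)}$ be real random variables. Let $\mathscr F=\mathscr F_n$ be the $\sigma$-field generated by $(\boldsymbol\alpha_i)_{i\le n}$ and $(\eta_l)_{l\le p}$, and assume $\mathbb E[u_{il}\mid\mathscr F]=0$. Let $\boldsymbol H=(\eta_l(\boldsymbol\alpha_i))_{l,i}$, $\boldsymbol U=(u_{il})_{l,i}$ and $\boldsymbol X=\boldsymbol H+\boldsymbol U$ be the $p\times n$ matrices whose $i$-th column belongs to unit $i$. Fix a set $\mathcal R^\dagger=\mathcal R^\dagger_n\subseteq\{1,\dots,p\}$ of rows, and let $\boldsymbol X^\dagger,\boldsymbol H^\dagger$ be the submatrices with these rows. Let $\rho=\rho_n$ be any rule that assigns to a matrix with columns $\boldsymbol v_1,\dots,\boldsymbol v_n$ real numbers $\rho(\boldsymbol v_i,\boldsymbol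 v_j)$, $1\le i,j\le n$. The number $\rho(\boldsymbol v_i,\boldsymbol v_j)$ may also depend on $i$, $j$ and the other columns, and no metric axioms are required. *Notation.* For random variables $Z_n$ and numbers $b_n>0$, $Z_n\lesssim_{\mathbb P}b_n$ (also written $Z_n=O_P(b_n)$) means $\lim_{\varepsilon\to\infty}\limsup_n\mathbb P[|Z_n/b_n|\ge\varepsilon]=0$, and $Z_n\gtrsim_{\mathbb P}1$ means $\lim_{\varepsilon\to\infty}\limsup_n\mathbb P[\varepsilon Z_n\le 1]=0$. $\mathbb P$ of a non-measurable set is outer probability. *Regularity conditions.* (a) For each $n$, $(\boldsymbol\alpha_i)_{i\le n}$ is i.i.d. with a Lebesgue density supported on a fixed compact convex set $\mathcal A\subset\mathbb R^r$; the density satisfies $c\le f_n\le C$ on $\mathcal A$ with constants $0<c\le C$ not depending on $n$. (b) For some integer $\bar m\ge2$, almost surely every $\eta_l$ is $\bar m$-times continuously differentiable on $\mathcal A$, with all partial derivatives of order at most $\bar m$ bounded on $\mathcal A$ by a universal constant. (c) The $u_{il}$ are independent over $i$ and $l$ conditionally on $\mathscr F$, and for some $\nu>0$, $\max_{i,l}\mathbb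 E[|u_{il}|^{2+\nu}\mid\mathscr F]<\infty$ almost surely. *Indirect matching condition.* For constants $\rho_0\ge0$, $\underline\varsigma>0$, $\bar\varsigma>0$ and a positive sequence $a_n\to0$: (a) $\displaystyle\max_{i\ne j}\big|\rho(\boldsymbol X^\dagger_{\cdot i},\boldsymbol X^\dagger_{\cdot j})-\rho(\boldsymbol H^\dagger_{\cdot i},\boldsymbol H^\dagger_{\cdot j})-\rho_0\big|\lesssim_{\mathbb P}a_n$; (b) $\displaystyle\max_{\boldsymbol\alpha_i\ne\boldsymbol\alpha_j}\frac{\rho(\boldsymbol H^\dagger_{\cdot i},\boldsymbol H^\dagger_{\cdot j})}{\|\boldsymbol\alpha_i-\boldsymbol\alpha_j\|^{\bar\varsigma}}\lesssim_{\mathbb P}1$ and $\displaystyle\min_{\boldsymbol\alpha_i\ne\boldsymbol\alpha_j}\frac{\rho(\boldsymbol H^\dagger_{\cdot i},\boldsymbol H^\dagger_{\cdot j})}{\|\boldsymbol\alpha_i-\boldsymbol\alpha_j\|^{\underline\varsigma}}\gtrsim_{\mathbb P}1$. *Nearest neighbours.* Let $1\le K=K_n\le n$, and for each unit $i$ let $j_1(i),\dots,j_K(i)$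 be distinct indices of $K$ nearest neighbours of $i$ in terms of $\rho(\boldsymbol X^\dagger_{\cdot i},\cdot)$, that is, $\rho(\boldsymbol X^\dagger_{\cdot i},\boldsymbol X^\dagger_{\cdot j_k(i)})\le\rho(\boldsymbol X^\dagger_{\cdot i},\boldsymbol X^\dagger_{\cdot\ell})$ for all $k$ and all $\ell\notin\{j_1(i),\dots,j_K(i)\}$. The unit $i$ itself is an admissible neighbour, and ties are broken in an arbitrary way. *Conclusion.* If $\log(n/K)/K\to0$ and $K\log n/n\to0$ as $n\to\infty$, then $$\max_{1\le i\le n}\max_{1\le k\le K}\|\boldsymbol\alpha_i-\boldsymbol\alpha_{j_k(i)}\|\lesssim_{\mathbb P}(K/n)^{\bar\varsigma/(\underline\varsigma r)}+a_n^{1/\underline\varsigma}.$$ -/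

import Mathlib

open MeasureTheory ProbabilityTheory Filter Topology
open scoped ENNReal

namespace IndirectMatching

/-! ### Stochastic orders -/

/-- `Z n ≲_P b n`: the `limsup` in `n` of `P[|Z n / b n| ≥ ε]` tends to `0` as `ε → ∞`. -/
def IsBigOP {Ω : Type*} [MeasurableSpace Ω] (P : Measure Ω) (Z : ℕ → Ω → ℝ) (b : ℕ → ℝ) : Prop :=
  Tendsto (fun ε : ℝ => limsup (fun n => P {ω | ε ≤ |Z n ω / b n|}) atTop) atTop (𝓝 0)

/-- `Z n ≳_P b n` for positive `b n`: the `limsup` in `n` of `P[b n / Z n ≥ ε]` tends to `0` as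
`ε → ∞`, where a nonpositive value of `Z n` counts as `b n / Z n = ∞`. -/
def IsBigOmegaP {Ω : Type*} [MeasurableSpace Ω] (P : Measure Ω) (Z : ℕ → Ω → ℝ) (b : ℕ → ℝ) :
    Prop :=
  Tendsto (fun ε : ℝ => limsup (fun n => P {ω | ε * Z n ω ≤ b n}) atTop) atTop (𝓝 0)

/-! ### Conditional notions relative to a sub-σ-field -/

/-- Conditional independence of a family of real random variables given the σ-field `m`:
conditional probabilities of finite intersections factor almost surely. -/
def CondIndepFamily {Ω ι : Type*} [MeasurableSpace Ω] (P : Measure Ω) (m : MeasurableSpace Ω)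
    (X : ι → Ω → ℝ) : Prop :=
  ∀ (S : Finset ι) (B : ι → Set ℝ), (∀ i, MeasurableSet (B i)) →
    P⟦⋂ i ∈ S, X i ⁻¹' B i | m⟧ =ᵐ[P] fun ω => ∏ i ∈ S, (P⟦X i ⁻¹' B i | m⟧) ω

/-- The conditional mean of `X` given `m` exists and vanishes almost surely: `E[|X| | m] < ∞` and
`E[X⁺ | m] = E[X⁻ | m]`, with conditional expectations of `[0, ∞]`-valued random variables
(so `X` need not be unconditionally integrable). -/
def CondMeanZero {Ω : Type*} [MeasurableSpace Ω] (P : Measure Ω) (m : MeasurableSpace Ω)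
    (X : Ω → ℝ) : Prop :=
  (∀ᵐ ω ∂P, condLExp m P (fun ω => ENNReal.ofReal |X ω|) ω < ∞) ∧
    condLExp m P (fun ω => ENNReal.ofReal (X ω)) =ᵐ[P]
      condLExp m P (fun ω => ENNReal.ofReal (-X ω))

/-! ### The nonlinear factor model -/

/-- The random elements of the nonlinear factor model with `n` units, `p` features and `r` latent
variables: `α i` is the latent vector of unit `i`, `η ω l` is the (random) latent function of
feature `l`, and `u i l` is the idiosyncratic error. -/
structure FactorModel (Ω : Type*) [MeasurableSpace Ω] (r n p : ℕ) where
  α : Fin n → Ω → EuclideanSpace ℝ (Fin r)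
  η : Ω → Fin p → EuclideanSpace ℝ (Fin r) → ℝ
  u : Fin n → Fin p → Ω → ℝ
  measurable_α : ∀ i, Measurable (α i)
  measurable_η : ∀ l a, Measurable fun ω => η ω l a
  measurable_u : ∀ i l, Measurable (u i l)

namespace FactorModel

variable {Ω : Type*} [MeasurableSpace Ω] {r n p : ℕ}

/-- The noise-free matrix `H`: its `i`-th column is `(η_1(α_i), …, η_p(α_i))`. -/
def H (M : FactorModel Ω r n p) (ω : Ω) : Fin n → Fin p → ℝ :=
  fun i l => M.η ω l (M.α i ω)

/-- The observed data matrix `X = H + U`, as the family of its columns. -/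
def X (M : FactorModel Ω r n p) (ω : Ω) : Fin n → Fin p → ℝ :=
  fun i l => M.H ω i l + M.u i l ω

/-- The σ-field generated by the latent variables and the latent functions. -/
abbrev sigmaF (M : FactorModel Ω r n p) : MeasurableSpace Ω :=
  (⨆ i, MeasurableSpace.comap (M.α i) inferInstance) ⊔
    ⨆ l, ⨆ a, MeasurableSpace.comap (fun ω => M.η ω l a) inferInstance

end FactorModel

/-- The submatrix of a `p × n` matrix (given by its columns) with row indices in `R`. -/
def rows {n p : ℕ} (R : Finset (Fin p)) (Y : Fin n → Fin p → ℝ) : Fin n → R → ℝ :=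
  fun i l => Y i l

/-! ### Standing assumptions -/

/-- The error terms have conditional mean zero given the latent variables and functions. -/
def ErrorsCentered {Ω : Type*} [MeasurableSpace Ω] (P : Measure Ω) {r : ℕ} {p : ℕ → ℕ}
    (M : ∀ n, FactorModel Ω r n (p n)) : Prop :=
  ∀ n i l, CondMeanZero P (M n).sigmaF ((M n).u i l)

/-- The latent vectors are i.i.d. on the compact convex support `A`, with Lebesgue densities that
are bounded and bounded away from zero on `A`, with bounds that do not depend on `n`. -/
def RegularLatent {Ω : Type*} [MeasurableSpace Ω] (P : Measure Ω) {r : ℕ} {p : ℕ → ℕ}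
    (A : Set (EuclideanSpace ℝ (Fin r))) (M : ∀ n, FactorModel Ω r n (p n)) : Prop :=
  IsCompact A ∧ Convex ℝ A ∧ (∀ n, iIndepFun (M n).α P) ∧
    ∃ (f : ℕ → EuclideanSpace ℝ (Fin r) → ℝ) (c C : ℝ), 0 < c ∧
      (∀ n, Measurable (f n)) ∧ (∀ n, ∀ a ∈ A, c ≤ f n a ∧ f n a ≤ C) ∧
      ∀ n i, P.map ((M n).α i) =
        (volume.restrict A).withDensity fun a => ENNReal.ofReal (f n a)

/-- Almost surely, each latent function is `m`-times continuously differentiable on `A` for some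
`m ≥ 2`, with all partial derivatives of order at most `m` bounded by a universal constant.
Derivatives are taken within `A`. -/
def RegularFunctions {Ω : Type*} [MeasurableSpace Ω] (P : Measure Ω) {r : ℕ} {p : ℕ → ℕ}
    (A : Set (EuclideanSpace ℝ (Fin r))) (M : ∀ n, FactorModel Ω r n (p n)) : Prop :=
  ∃ (m : ℕ) (C : ℝ), 2 ≤ m ∧ ∀ n, ∀ᵐ ω ∂P, ∀ l,
    ContDiffOn ℝ m ((M n).η ω l) A ∧
    ∀ k ≤ m, ∀ q : Fin k → Fin r, ∀ a ∈ A,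
      |iteratedFDerivWithin ℝ k ((M n).η ω l) A a
        (fun s => EuclideanSpace.single (q s) (1 : ℝ))| ≤ C

/-- The errors are independent over units and features conditionally on the latent variables and
functions, with a finite conditional moment of order `2 + ν` for some `ν > 0`. -/
def RegularErrors {Ω : Type*} [MeasurableSpace Ω] (P : Measure Ω) {r : ℕ} {p : ℕ → ℕ}
    (M : ∀ n, FactorModel Ω r n (p n)) : Prop :=
  (∀ n, CondIndepFamily P (M n).sigmaF fun q : Fin n × Fin (p n) => (M n).u q.1 q.2) ∧
    ∃ ν : ℝ, 0 < ν ∧ ∀ n, ∀ᵐ ω ∂P, ∀ i l,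
      condLExp (M n).sigmaF P
        (fun ω' => ENNReal.ofReal (|(M n).u i l ω'| ^ (2 + ν))) ω < ∞

/-! ### Distances and nearest neighbours -/

/-- A rule that assigns to the matrix with columns `V 1, …, V n` a "distance" between any two of its
columns. The rule may use the whole matrix, as the pseudo-max distance does; a function
`d` of two vectors gives the rule `fun V i j => d (V i) (V j)`. No metric axioms are imposed. -/
abbrev DistanceRule (n : ℕ) (κ : Type*) := (Fin n → κ → ℝ) → Fin n → Fin n → ℝ

/-- The distance denoises the data up to `a n`: for distinct units, the distance between the
observed columns is that between the noise-free columns plus `ρ₀`, up to `O_P(a n)` uniformly. -/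
def Denoises {Ω : Type*} [MeasurableSpace Ω] (P : Measure Ω) {r : ℕ} {p : ℕ → ℕ}
    (M : ∀ n, FactorModel Ω r n (p n)) (R : ∀ n, Finset (Fin (p n)))
    (ρ : ∀ n, DistanceRule n (R n)) (ρ₀ : ℝ) (a : ℕ → ℝ) : Prop :=
  IsBigOP P
    (fun n ω => ⨆ q : {q : Fin n × Fin n // q.1 ≠ q.2},
      |ρ n (rows (R n) ((M n).X ω)) q.1.1 q.1.2 -
        ρ n (rows (R n) ((M n).H ω)) q.1.1 q.1.2 - ρ₀|) a

/-- The noise-free distance is at most of the order of the power `s` of the latent distance. -/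
def UpperPower {Ω : Type*} [MeasurableSpace Ω] (P : Measure Ω) {r : ℕ} {p : ℕ → ℕ}
    (M : ∀ n, FactorModel Ω r n (p n)) (R : ∀ n, Finset (Fin (p n)))
    (ρ : ∀ n, DistanceRule n (R n)) (s : ℝ) : Prop :=
  IsBigOP P
    (fun n ω => ⨆ q : {q : Fin n × Fin n // (M n).α q.1 ω ≠ (M n).α q.2 ω},
      ρ n (rows (R n) ((M n).H ω)) q.1.1 q.1.2 /
        ‖(M n).α q.1.1 ω - (M n).α q.1.2 ω‖ ^ s) (fun _ => 1)

/-- The noise-free distance is at least of the order of the power `s` of the latent distance. -/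
def LowerPower {Ω : Type*} [MeasurableSpace Ω] (P : Measure Ω) {r : ℕ} {p : ℕ → ℕ}
    (M : ∀ n, FactorModel Ω r n (p n)) (R : ∀ n, Finset (Fin (p n)))
    (ρ : ∀ n, DistanceRule n (R n)) (s : ℝ) : Prop :=
  IsBigOmegaP P
    (fun n ω => ⨅ q : {q : Fin n × Fin n // (M n).α q.1 ω ≠ (M n).α q.2 ω},
      ρ n (rows (R n) ((M n).H ω)) q.1.1 q.1.2 /
        ‖(M n).α q.1.1 ω - (M n).α q.1.2 ω‖ ^ s) (fun _ => 1)

/-- `j i 1, …, j i K` enumerates `K` nearest neighbours of each unit `i` with respect to the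
pairwise distances `d`: they are distinct, and no unit outside the list is strictly closer to `i`
than a unit in the list. Ties may be broken in any way. -/
def IsNearestNeighbors {n K : ℕ} (d : Fin n → Fin n → ℝ) (j : Fin n → Fin K → Fin n) : Prop :=
  ∀ i, Function.Injective (j i) ∧
    ∀ k ℓ, ℓ ∉ Set.range (j i) → d i (j i k) ≤ d i ℓ

/-- The set of all `j` such that at most `K` units `ℓ` have `d i ℓ ≤ d i j`. -/
noncomputable def neighborSet {n : ℕ} (d : Fin n → Fin n → ℝ) (K : ℕ) (i : Fin n) :
    Finset (Fin n) :=
  Finset.univ.filter fun j => (Finset.univ.filter fun ℓ => d i ℓ ≤ d i j).card ≤ K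

/-- Every member of `neighborSet` occurs in every enumeration of nearest neighbours. -/
theorem neighborSet_subset {n K : ℕ} {d : Fin n → Fin n → ℝ} {j : Fin n → Fin K → Fin n}
    (h : IsNearestNeighbors d j) (i : Fin n) :
    neighborSet d K i ⊆ Finset.univ.image (j i) := by
  intro x hx
  by_contra hx'
  have hcard : (Finset.univ.image (j i)).card = K := by
    rw [Finset.card_image_of_injective _ (h i).1]; simp
  have hsub : insert x (Finset.univ.image (j i)) ⊆
      Finset.univ.filter fun ℓ => d i ℓ ≤ d i x := by
    intro y hy
    rw [Finset.mem_insert] at hy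
    rw [Finset.mem_filter]
    refine ⟨Finset.mem_univ _, ?_⟩
    rcases hy with rfl | hy
    · exact le_rfl
    · obtain ⟨k, -, rfl⟩ := Finset.mem_image.1 hy
      exact (h i).2 k x (by simpa using hx')
  have h1 := Finset.card_le_card hsub
  rw [Finset.card_insert_of_notMem hx', hcard] at h1
  have h2 := (Finset.mem_filter.1 hx).2
  omega

/-- If `neighborSet` has exactly `K` elements (as it does without ties, when `K ≤ n`), the
enumerations of nearest neighbours are exactly its enumerations. -/
theorem image_eq_neighborSet {n K : ℕ} {d : Fin n → Fin n → ℝ} {j : Fin n → Fin K → Fin n}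
    (h : IsNearestNeighbors d j) (i : Fin n) (hK : (neighborSet d K i).card = K) :
    Finset.univ.image (j i) = neighborSet d K i := by
  refine (Finset.eq_of_subset_of_card_le (neighborSet_subset h i) ?_).symm
  rw [Finset.card_image_of_injective _ (h i).1, hK]; simp

end IndirectMatching

namespace IndirectMatching

/-! Write κ = K/n. A latent ball of radius h of order κ^(1/r) around any unit holds at least K other
units with distinct latent vectors. On the event where the distance bounds hold, each of these has
observed distance from i at most ρ₀ + O(h^ςup + a_n). A selected neighbour lying farther than that
would force all K of them into the list beside it, making K + 1 entries. So every selected neighbour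
obeys the same bound; subtracting ρ₀ and using the lower power bound gives a latent distance to the
power ςlow of order κ^(ςup/r) + a_n. This is `IsNearestNeighbors.norm_rpow_le`, which is
deterministic.

The probabilistic input is `RegularLatent.exists_eventually_ncard_lt_le`. Convexity and the lower
density bound give such balls mass at least a constant times κ. A Chernoff bound on E[2^(-N)], with
N the number of other units in the ball, and a union over the units finish the count, because log n
≤ K eventually. -/

/-! ### Lower tails of neighbour counts -/

/-- Integrating a weight `1/2` on a set `T` of mass at least `q`. -/
theorem lintegral_half_weight_le {E : Type*} [MeasurableSpace E] (μ : Measure E)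
    [IsProbabilityMeasure μ] {T : Set E} [DecidablePred (· ∈ T)] (hT : MeasurableSet T) {q : ℝ}
    (hq : ENNReal.ofReal q ≤ μ T) :
    ∫⁻ y, (if y ∈ T then (2⁻¹ : ℝ≥0∞) else 1) ∂μ ≤ ENNReal.ofReal (Real.exp (-(q / 2))) := by
  have hm : Measurable fun y => if y ∈ T then (2⁻¹ : ℝ≥0∞) else 1 :=
    Measurable.ite hT measurable_const measurable_const
  -- The weight is 1 - 1_T/2, so its integral is 1 - μ(T)/2 ≤ 1 - q/2 ≤ exp(-q/2).
  have h1 : (∫⁻ y, (if y ∈ T then (2⁻¹ : ℝ≥0∞) else 1) ∂μ) + 2⁻¹ * μ T = 1 := by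
    rw [← setLIntegral_const, ← lintegral_indicator hT, ← lintegral_add_left hm]
    have : ∀ y, (if y ∈ T then (2⁻¹ : ℝ≥0∞) else 1) + T.indicator (fun _ => 2⁻¹) y = 1 := by
      intro y
      by_cases hy : y ∈ T
      · simp [hy, ENNReal.inv_two_add_inv_two]
      · simp [hy]
    simp [this]
  have h2 : (∫⁻ y, (if y ∈ T then (2⁻¹ : ℝ≥0∞) else 1) ∂μ) + ENNReal.ofReal (q / 2) ≤ 1 := by
    refine le_of_le_of_eq ?_ h1
    gcongr
    rw [div_eq_inv_mul, ENNReal.ofReal_mul (by norm_num)]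
    gcongr
    rw [ENNReal.ofReal_inv_of_pos (by norm_num)]
    simp
  refine (ENNReal.le_sub_of_add_le_right ENNReal.ofReal_ne_top h2).trans ?_
  rw [tsub_le_iff_right, ← ENNReal.ofReal_one]
  refine (ENNReal.ofReal_le_ofReal ?_).trans ENNReal.ofReal_add_le
  linarith [Real.add_one_le_exp (-(q / 2))]

theorem lintegral_prod_half_weight_le {E : Type*} [MeasurableSpace E] {n : ℕ}
    (μ : Fin n → Measure E) [∀ i, IsProbabilityMeasure (μ i)] {T : Set E}
    [DecidablePred (· ∈ T)] (hT : MeasurableSet T) {q : ℝ}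
    (hq : ∀ i, ENNReal.ofReal q ≤ μ i T) :
    ∫⁻ y : Fin n → E, ∏ i, (if y i ∈ T then (2⁻¹ : ℝ≥0∞) else 1) ∂Measure.pi μ ≤
      ENNReal.ofReal (Real.exp (-(n * q / 2))) := by
  have hm : Measurable fun y => if y ∈ T then (2⁻¹ : ℝ≥0∞) else 1 :=
    Measurable.ite hT measurable_const measurable_const
  have hind := iIndepFun_pi (μ := μ) (X := fun _ y => if y ∈ T then (2⁻¹ : ℝ≥0∞) else 1)
    fun _ => hm.aemeasurable
  rw [lintegral_prod_eq_prod_lintegral_of_indepFun Finset.univ _ hind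
    fun i => hm.comp (measurable_pi_apply i)]
  have h1 : ∀ i, ∫⁻ y : Fin n → E, (if y i ∈ T then (2⁻¹ : ℝ≥0∞) else 1) ∂Measure.pi μ ≤
      ENNReal.ofReal (Real.exp (-(q / 2))) := fun i => by
    rw [(measurePreserving_eval μ i).lintegral_comp hm]
    exact lintegral_half_weight_le _ hT (hq i)
  refine (Finset.prod_le_prod' fun i _ => h1 i).trans (le_of_eq ?_)
  rw [Finset.prod_const, Finset.card_univ, Fintype.card_fin,
    ← ENNReal.ofReal_pow (Real.exp_pos _).le, ← Real.exp_nat_mul]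
  congr 2
  ring

/-- Lower tail bound for the number of members of an independent family that are related to a
given member. -/
theorem measure_card_related_lt_le {Ω E : Type*} [MeasurableSpace Ω] [MeasurableSpace E]
    (P : Measure Ω) [IsProbabilityMeasure P] {n : ℕ} (X : Fin (n + 1) → Ω → E)
    (hX : ∀ i, Measurable (X i)) (hind : iIndepFun X P) (S : E → E → Prop)
    (hS : MeasurableSet {z : E × E | S z.1 z.2}) (i : Fin (n + 1)) {q : ℝ}
    (hq : ∀ᵐ x ∂P.map (X i), ∀ ℓ, ENNReal.ofReal q ≤ P.map (X ℓ) {y | S x y}) (K : ℕ) :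
    P {ω | {ℓ | S (X i ω) (X ℓ ω)}.ncard < K} ≤
      2 ^ K * ENNReal.ofReal (Real.exp (-(n * q / 2))) := by
  classical
  have hprob : ∀ i, IsProbabilityMeasure (P.map (X i)) := fun i =>
    Measure.isProbabilityMeasure_map (hX i).aemeasurable
  have hm : Measurable fun z : E × E => if S z.1 z.2 then (2⁻¹ : ℝ≥0∞) else 1 :=
    Measurable.ite hS measurable_const measurable_const
  -- At the sample, `G` is 2^(-N), where N counts the related members other than `i`. Leaving out
  -- `i` itself can only lower the count.
  set G : E × (Fin n → E) → ℝ≥0∞ := fun z => ∏ k, if S z.1 (z.2 k) then 2⁻¹ else 1 with hG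
  have hGm : Measurable G := Finset.measurable_fun_prod _ fun k _ =>
    hm.comp (measurable_fst.prodMk ((measurable_pi_apply k).comp measurable_snd))
  set V : Ω → E × (Fin n → E) := fun ω => (X i ω, fun k => X (i.succAbove k) ω) with hV
  have hVm : Measurable V :=
    (hX i).prodMk (measurable_pi_lambda _ fun k => hX (i.succAbove k))
  -- Independence of member `i` from the others makes the joint law a product, so the first
  -- coordinate can be frozen by Tonelli.
  have hlaw : P.map V = (P.map (X i)).prod (Measure.pi fun k => P.map (X (i.succAbove k))) := by
    rw [← (measurePreserving_piFinSuccAbove (fun i => P.map (X i)) i).map_eq,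
      ← (iIndepFun_iff_map_fun_eq_pi_map fun i => (hX i).aemeasurable).1 hind,
      Measure.map_map (MeasurableEquiv.measurable _) (measurable_pi_lambda _ hX)]
    rfl
  have hint : ∫⁻ ω, G (V ω) ∂P ≤ ENNReal.ofReal (Real.exp (-(n * q / 2))) := by
    rw [← lintegral_map hGm hVm, hlaw, lintegral_prod _ hGm.aemeasurable]
    calc _ ≤ ∫⁻ _, ENNReal.ofReal (Real.exp (-(n * q / 2))) ∂P.map (X i) := by
          refine lintegral_mono_ae ?_
          filter_upwards [hq] with x hx
          exact lintegral_prod_half_weight_le (T := {y | S x y}) _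
            (measurable_prodMk_left hS) fun k => hx (i.succAbove k)
      _ = _ := by simp
  have hpoint : ∀ ω, {ℓ | S (X i ω) (X ℓ ω)}.ncard < K → (2⁻¹ : ℝ≥0∞) ^ K ≤ G (V ω) := by
    intro ω hω
    have hcard : (Finset.univ.filter fun k => S (X i ω) (X (i.succAbove k) ω)).card ≤ K := by
      refine le_trans ?_ hω.le
      rw [← Finset.card_map (Fin.succAboveEmb i), ← Set.ncard_coe_finset]
      refine Set.ncard_le_ncard ?_ (Set.toFinite _)
      intro ℓ hℓ
      simp only [Finset.coe_map, Set.mem_image, Finset.mem_coe, Finset.mem_filter] at hℓ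
      obtain ⟨k, ⟨-, hk⟩, rfl⟩ := hℓ
      exact hk
    simp only [hG, hV]
    rw [Finset.prod_ite, Finset.prod_const, Finset.prod_const_one, mul_one]
    exact pow_le_pow_right_of_le_one' (by simp) hcard
  -- Markov's inequality for 2^(-N) at level 2^(-K).
  calc _ ≤ P {ω | (2⁻¹ : ℝ≥0∞) ^ K ≤ G (V ω)} := measure_mono hpoint
    _ ≤ (∫⁻ ω, G (V ω) ∂P) / 2⁻¹ ^ K :=
        meas_ge_le_lintegral_div (hGm.comp hVm).aemeasurable (by simp) (by simp)
    _ ≤ _ := by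
        rw [ENNReal.div_eq_inv_mul, ENNReal.inv_pow, inv_inv]
        gcongr

/-! ### Volume of balls in a convex set -/

/-- Small balls around points of a bounded convex set contain a share of its volume. -/
theorem pow_mul_volume_le_volume_inter_closedBall {r : ℕ} {A : Set (EuclideanSpace ℝ (Fin r))}
    (hA : Convex ℝ A) {D : ℝ} (hD : ∀ x ∈ A, ∀ y ∈ A, dist y x ≤ D)
    {x : EuclideanSpace ℝ (Fin r)} (hx : x ∈ A) {t : ℝ} (ht0 : 0 ≤ t) (ht1 : t ≤ 1) :
    ENNReal.ofReal (t ^ r) * volume A ≤ volume (A ∩ Metric.closedBall x (t * D)) := by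
  -- Shrinking `A` towards `x` by the factor `t` scales volume by t^r, stays in `A` by convexity,
  -- and lands within distance tD of `x`.
  have h := Measure.addHaar_image_homothety (volume : Measure (EuclideanSpace ℝ (Fin r))) x t A
  rw [finrank_euclideanSpace_fin, abs_of_nonneg (pow_nonneg ht0 r)] at h
  rw [← h]
  refine measure_mono ?_
  rintro _ ⟨y, hy, rfl⟩
  refine ⟨?_, ?_⟩
  · rw [AffineMap.homothety_eq_lineMap]
    exact hA.lineMap_mem hx hy ⟨ht0, ht1⟩
  · rw [Metric.mem_closedBall, dist_homothety_center, Real.norm_of_nonneg ht0, dist_comm]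
    exact mul_le_mul_of_nonneg_left (hD x hx y hy) ht0

/-! ### Deterministic bound for nearest neighbours -/

/-- The nearest neighbours are close in the latent space on the event that the distance denoises
and is comparable with powers of the latent distance, if every ball has enough points. -/
theorem IsNearestNeighbors.norm_rpow_le {E : Type*} [NormedAddCommGroup E] {n K : ℕ}
    {dX dH : Fin n → Fin n → ℝ} {x : Fin n → E} {j : Fin n → Fin K → Fin n}
    (hj : IsNearestNeighbors dX j) {ρ₀ e₁ e₂ e₃ h s t : ℝ} (he₂ : 0 ≤ e₂) (he₃ : 0 ≤ e₃)
    (hs : 0 < s) (ht : 0 < t)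
    (hdX : ∀ i ℓ, i ≠ ℓ → |dX i ℓ - dH i ℓ - ρ₀| ≤ e₁)
    (hup : ∀ i ℓ, x i ≠ x ℓ → dH i ℓ ≤ e₂ * ‖x i - x ℓ‖ ^ t)
    (hlow : ∀ i ℓ, x i ≠ x ℓ → ‖x i - x ℓ‖ ^ s ≤ e₃ * dH i ℓ)
    (hball : ∀ i, K ≤ {ℓ | x i ≠ x ℓ ∧ ‖x i - x ℓ‖ ≤ h}.ncard) (hh : 0 ≤ h) (he₁ : 0 ≤ e₁)
    (i : Fin n) (k : Fin K) :
    ‖x i - x (j i k)‖ ^ s ≤ e₃ * (e₂ * h ^ t + 2 * e₁) := by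
  classical
  have hT0 : 0 ≤ e₃ * (e₂ * h ^ t + 2 * e₁) := by positivity
  by_cases hne : x i = x (j i k)
  · rw [hne, sub_self, norm_zero, Real.zero_rpow hs.ne']
    exact hT0
  have hik : i ≠ j i k := fun hc => hne (congrArg x hc)
  refine (hlow i _ hne).trans (mul_le_mul_of_nonneg_left ?_ he₃)
  have hclose : dX i (j i k) ≤ e₂ * h ^ t + ρ₀ + e₁ := by
    by_contra hcon
    push Not at hcon
    -- Each point of the ball is strictly closer to `i` than `j i k`, hence is listed and differs
    -- from `j i k`. Only K - 1 places remain for at least K points.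
    have hsub : {ℓ | x i ≠ x ℓ ∧ ‖x i - x ℓ‖ ≤ h} ⊆ Set.range (j i) \ {j i k} := by
      rintro ℓ ⟨hℓ1, hℓ2⟩
      have h1 := (abs_le.1 (hdX i ℓ fun hc => hℓ1 (congrArg x hc))).2
      have h2 : e₂ * ‖x i - x ℓ‖ ^ t ≤ e₂ * h ^ t :=
        mul_le_mul_of_nonneg_left (Real.rpow_le_rpow (norm_nonneg _) hℓ2 ht.le) he₂
      have h3 := hup i ℓ hℓ1
      have h4 : dX i ℓ < dX i (j i k) := by linarith
      refine ⟨?_, ?_⟩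
      · by_contra hℓ
        exact absurd ((hj i).2 k ℓ hℓ) (not_le.2 h4)
      · rintro rfl
        exact lt_irrefl _ h4
    have h5 := (hball i).trans (Set.ncard_le_ncard hsub (Set.toFinite _))
    have h6 : (Set.range (j i)).ncard = K := by
      rw [← Set.image_univ, Set.ncard_image_of_injective _ (hj i).1, Set.ncard_univ]
      simp
    have h7 := Set.ncard_sdiff_singleton_lt_of_mem (Set.mem_range_self (f := j i) k)
      (Set.toFinite _)
    omega
  have h1 := (abs_le.1 (hdX i _ hik)).1
  linarith

/-! ### Stochastic orders -/

theorem IsBigOP.exists_eventually_le {Ω : Type*} [MeasurableSpace Ω] {P : Measure Ω}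
    {Z : ℕ → Ω → ℝ} {b : ℕ → ℝ} (h : IsBigOP P Z b) {δ : ℝ≥0∞} (hδ : 0 < δ) :
    ∃ e : ℝ, 0 < e ∧ ∀ᶠ n in atTop, P {ω | e ≤ |Z n ω / b n|} ≤ δ := by
  obtain ⟨e, he, he0⟩ := ((h.eventually (gt_mem_nhds hδ)).and (eventually_gt_atTop 0)).exists
  exact ⟨e, he0, (eventually_lt_of_limsup_lt he).mono fun n hn => hn.le⟩

theorem IsBigOmegaP.exists_eventually_le {Ω : Type*} [MeasurableSpace Ω] {P : Measure Ω}
    {Z : ℕ → Ω → ℝ} {b : ℕ → ℝ} (h : IsBigOmegaP P Z b) {δ : ℝ≥0∞} (hδ : 0 < δ) :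
    ∃ e : ℝ, 0 < e ∧ ∀ᶠ n in atTop, P {ω | e * Z n ω ≤ b n} ≤ δ := by
  obtain ⟨e, he, he0⟩ := ((h.eventually (gt_mem_nhds hδ)).and (eventually_gt_atTop 0)).exists
  exact ⟨e, he0, (eventually_lt_of_limsup_lt he).mono fun n hn => hn.le⟩

/-- The events shrink as the threshold grows, so one threshold for each `δ` suffices. They need not
be measurable: only monotonicity of `P` is used. -/
theorem isBigOP_of_exists_eventually_le {Ω : Type*} [MeasurableSpace Ω] {P : Measure Ω}
    {Z : ℕ → Ω → ℝ} {b : ℕ → ℝ}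
    (h : ∀ δ : ℝ≥0∞, 0 < δ → ∃ e : ℝ, ∀ᶠ n in atTop, P {ω | e ≤ |Z n ω / b n|} ≤ δ) :
    IsBigOP P Z b := by
  refine ENNReal.tendsto_nhds_zero.2 fun δ hδ => ?_
  obtain ⟨e, he⟩ := h δ hδ
  filter_upwards [eventually_ge_atTop e] with ε hε
  refine limsup_le_of_le (by isBoundedDefault) ?_
  filter_upwards [he] with n hn
  exact (measure_mono fun ω hω => hε.trans hω).trans hn

/-! ### Counting latent neighbours uniformly -/

/-- Split log n = log(n/K) + log K: the first term is eventually below K/2, and the second is at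
most K/2 - 1 + log 2. This lets the exponential tail in K absorb the union over n units. -/
theorem eventually_log_le {K : ℕ → ℕ} (hK : ∀ n, 1 ≤ n → 1 ≤ K n ∧ K n ≤ n)
    (hK_large : Tendsto (fun n : ℕ => Real.log ((n : ℝ) / K n) / K n) atTop (𝓝 0)) :
    ∀ᶠ n : ℕ in atTop, Real.log n ≤ K n := by
  filter_upwards [hK_large.eventually (gt_mem_nhds (show (0 : ℝ) < 1 / 2 by norm_num)),
    eventually_ge_atTop 1] with n hn hn1
  have hK0 : (0 : ℝ) < K n := by exact_mod_cast (hK n hn1).1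
  have hn0 : (0 : ℝ) < n := by exact_mod_cast hn1
  rw [div_lt_iff₀ hK0, Real.log_div hn0.ne' hK0.ne'] at hn
  have h1 := Real.log_le_sub_one_of_pos (half_pos hK0)
  rw [Real.log_div hK0.ne' two_ne_zero] at h1
  have h2 := Real.log_two_lt_d9
  linarith

theorem tendsto_div_zero {K : ℕ → ℕ}
    (hK_small : Tendsto (fun n : ℕ => (K n : ℝ) * Real.log n / n) atTop (𝓝 0)) :
    Tendsto (fun n : ℕ => (K n : ℝ) / n) atTop (𝓝 0) := by
  refine squeeze_zero' (Eventually.of_forall fun n => by positivity) ?_ hK_small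
  filter_upwards [(Real.tendsto_log_atTop.comp tendsto_natCast_atTop_atTop).eventually_ge_atTop 1]
    with n hn
  gcongr
  exact le_mul_of_one_le_right (Nat.cast_nonneg _) hn

/-- Uniformly over the units, balls of radius of the order `(K n / n) ^ (1 / r)` contain at least
`K n` other latent vectors, with probability tending to one. -/
theorem RegularLatent.exists_eventually_ncard_lt_le {Ω : Type*} [MeasurableSpace Ω]
    {P : Measure Ω} [IsProbabilityMeasure P] {r : ℕ} (hr : 1 ≤ r) {p : ℕ → ℕ}
    {M : ∀ n, FactorModel Ω r n (p n)} {A : Set (EuclideanSpace ℝ (Fin r))}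
    (hlatent : RegularLatent P A M) {K : ℕ → ℕ} (hK : ∀ n, 1 ≤ n → 1 ≤ K n ∧ K n ≤ n)
    (hK_large : Tendsto (fun n : ℕ => Real.log ((n : ℝ) / K n) / K n) atTop (𝓝 0))
    (hK_small : Tendsto (fun n : ℕ => (K n : ℝ) * Real.log n / n) atTop (𝓝 0)) :
    ∃ L : ℝ, 0 < L ∧ ∀ᶠ n : ℕ in atTop,
      P {ω | ∃ i, {ℓ | (M n).α i ω ≠ (M n).α ℓ ω ∧
        ‖(M n).α i ω - (M n).α ℓ ω‖ ≤ L * ((K n : ℝ) / n) ^ (1 / (r : ℝ))}.ncard < K n} ≤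
      ENNReal.ofReal (1 / n) := by
  obtain ⟨hAc, hAconv, hind, f, c, C, hc, hfm, hf, hlaw⟩ := hlatent
  have : Nonempty (Fin r) := ⟨⟨0, hr⟩⟩
  have hAm : MeasurableSet A := hAc.measurableSet
  obtain ⟨D, hD0, hD⟩ : ∃ D : ℝ, 0 < D ∧ ∀ x ∈ A, ∀ y ∈ A, dist y x ≤ D := by
    obtain ⟨D, hD⟩ := Metric.isBounded_iff.1 hAc.isBounded
    exact ⟨max D 1, by positivity, fun x hx y hy => (hD hy hx).trans (le_max_left _ _)⟩
  -- If `A` were null, the law of a latent vector would be the zero measure.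
  have hv : 0 < (volume A).toReal := by
    refine ENNReal.toReal_pos (fun h0 => ?_) hAc.measure_lt_top.ne
    have : IsProbabilityMeasure (P.map ((M 1).α 0)) :=
      Measure.isProbabilityMeasure_map ((M 1).measurable_α 0).aemeasurable
    have h1 := measure_univ (μ := P.map ((M 1).α 0))
    rw [hlaw 1 0, Measure.restrict_eq_zero.2 h0] at h1
    simp at h1
  set v := (volume A).toReal with hvdef
  have hr0 : (r : ℝ) ≠ 0 := by exact_mod_cast (by omega : r ≠ 0)
  -- This makes the guaranteed mass `q` equal to 12κ, which leaves exponent at least 3K in the tail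
  -- bound.
  set B := 12 / (c * v) with hB
  have hB0 : 0 < B := by positivity
  refine ⟨B ^ (1 / (r : ℝ)) * D, by positivity, ?_⟩
  have hKn := (tendsto_div_zero hK_small).eventually (gt_mem_nhds (inv_pos.2 hB0))
  filter_upwards [eventually_log_le hK hK_large, hKn, eventually_ge_atTop 2] with n hlog hsmall hn2
  obtain ⟨n, rfl⟩ : ∃ k, n = k + 1 := ⟨n - 1, by omega⟩
  set κ : ℝ := (K (n + 1) : ℝ) / (n + 1 : ℕ) with hκ
  have hκ0 : 0 ≤ κ := by positivity
  set t : ℝ := (B * κ) ^ (1 / (r : ℝ)) with ht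
  have ht0 : 0 ≤ t := by positivity
  have htr : t ^ r = B * κ := by
    rw [ht, ← Real.rpow_natCast, ← Real.rpow_mul (by positivity), one_div_mul_cancel hr0,
      Real.rpow_one]
  -- The homothety must shrink; this is where K/n → 0 enters.
  have ht1 : t ≤ 1 := by
    refine Real.rpow_le_one (by positivity) ?_ (by positivity)
    rw [← mul_one B⁻¹, lt_inv_mul_iff₀ hB0] at hsmall
    linarith
  have hrad : B ^ (1 / (r : ℝ)) * D * κ ^ (1 / (r : ℝ)) = t * D := by
    rw [ht, Real.mul_rpow hB0.le hκ0]; ring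
  rw [hrad]
  set S : EuclideanSpace ℝ (Fin r) → EuclideanSpace ℝ (Fin r) → Prop :=
    fun x y => x ≠ y ∧ ‖x - y‖ ≤ t * D with hS
  have hSm : MeasurableSet {z : EuclideanSpace ℝ (Fin r) × EuclideanSpace ℝ (Fin r) |
      S z.1 z.2} :=
    (measurableSet_eq_fun measurable_fst measurable_snd).compl.inter
      (measurableSet_le (measurable_fst.sub measurable_snd).norm measurable_const)
  set q : ℝ := c * (B * κ * v) with hq
  have hqκ : q = 12 * κ := by
    rw [hq, hB]; field_simp
  have hmass : ∀ x ∈ A, ∀ ℓ,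
      ENNReal.ofReal q ≤ P.map ((M (n + 1)).α ℓ) {y | S x y} := by
    intro x hx ℓ
    have hTm : MeasurableSet {y | S x y} := measurable_prodMk_left hSm
    rw [hlaw, withDensity_apply _ hTm, Measure.restrict_restrict hTm]
    -- Excluding the centre costs no volume, since points are null in dimension r ≥ 1.
    have hset : {y | S x y} ∩ A = (A ∩ Metric.closedBall x (t * D)) \ {x} := by
      ext y
      simp only [hS, Set.mem_inter_iff, Set.mem_ofPred_eq, Set.mem_sdiff, Set.mem_singleton_iff,
        Metric.mem_closedBall, dist_eq_norm, norm_sub_rev y x, ne_comm (a := x), ne_eq]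
      tauto
    have hvol : ENNReal.ofReal (B * κ * v) ≤ volume ({y | S x y} ∩ A) := by
      rw [hset, measure_sdiff_null (by simp)]
      refine le_trans (le_of_eq ?_)
        (pow_mul_volume_le_volume_inter_closedBall hAconv hD hx ht0 ht1)
      rw [htr, ENNReal.ofReal_mul (by positivity), hvdef,
        ENNReal.ofReal_toReal hAc.measure_lt_top.ne]
    calc ENNReal.ofReal q = ENNReal.ofReal c * ENNReal.ofReal (B * κ * v) :=
          ENNReal.ofReal_mul hc.le
      _ ≤ ENNReal.ofReal c * volume ({y | S x y} ∩ A) := by gcongr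
      _ = ∫⁻ _ in {y | S x y} ∩ A, ENNReal.ofReal c := (setLIntegral_const _ _).symm
      _ ≤ _ := setLIntegral_mono' (hTm.inter hAm) fun y hy =>
          ENNReal.ofReal_le_ofReal (hf _ y hy.2).1
  have hmass_ae : ∀ i, ∀ᵐ x ∂P.map ((M (n + 1)).α i), ∀ ℓ,
      ENNReal.ofReal q ≤ P.map ((M (n + 1)).α ℓ) {y | S x y} := by
    intro i
    rw [hlaw (n + 1) i]
    exact (withDensity_absolutelyContinuous _ _).ae_le
      ((ae_restrict_mem hAm).mono fun x hx => by simpa only [hlaw] using hmass x hx)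
  rw [Set.ofPred_exists]
  calc _ ≤ ∑ i, P {ω | {ℓ | S ((M (n + 1)).α i ω) ((M (n + 1)).α ℓ ω)}.ncard < K (n + 1)} :=
        measure_iUnion_fintype_le _ _
    _ ≤ ∑ _i : Fin (n + 1), 2 ^ K (n + 1) * ENNReal.ofReal (Real.exp (-(n * q / 2))) :=
        Finset.sum_le_sum fun i _ => measure_card_related_lt_le P _ (M (n + 1)).measurable_α
          (hind (n + 1)) S hSm i (hmass_ae i) _
    _ = ENNReal.ofReal ((n + 1 : ℕ) * (2 ^ K (n + 1) * Real.exp (-(n * q / 2)))) := by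
        rw [Finset.sum_const, Finset.card_univ, Fintype.card_fin, nsmul_eq_mul,
          ENNReal.ofReal_mul (by positivity), ENNReal.ofReal_mul (by positivity),
          ENNReal.ofReal_pow (by norm_num), ENNReal.ofReal_natCast, ENNReal.ofReal_ofNat]
    _ ≤ _ := ENNReal.ofReal_le_ofReal ?_
  have hN0 : (0 : ℝ) < (n + 1 : ℕ) := by positivity
  have hexpN : ((n + 1 : ℕ) : ℝ) ≤ Real.exp (K (n + 1)) := (Real.log_le_iff_le_exp hN0).1 hlog
  -- The sample size is n + 1 and only n other units count, so half of the factor 6 pays for n ≥ (n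
  -- + 1)/2.
  have hnq : 3 * (K (n + 1) : ℝ) ≤ n * q / 2 := by
    have h1 : κ * (n + 1 : ℕ) = K (n + 1) := div_mul_cancel₀ _ hN0.ne'
    have h2 : (1 : ℝ) ≤ n := by exact_mod_cast (by omega : 1 ≤ n)
    rw [hqκ, ← h1]
    push_cast
    nlinarith
  have h2K : (2 : ℝ) ^ K (n + 1) ≤ Real.exp (K (n + 1)) := by
    rw [← Real.exp_one_pow]
    gcongr
    linarith [Real.exp_one_gt_d9]
  rw [le_div_iff₀ hN0]
  -- The union over units, the factor 2^K and the target 1/(n + 1) each cost at most exp(K), exactly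
  -- balancing exp(-3K).
  calc _ ≤ Real.exp (K (n + 1)) * (Real.exp (K (n + 1)) * Real.exp (-(3 * K (n + 1)))) *
        Real.exp (K (n + 1)) := by gcongr
    _ = 1 := by
        rw [← Real.exp_add, ← Real.exp_add, ← Real.exp_add, Real.exp_eq_one_iff]
        ring

end IndirectMatching

/-! ### The rate for indirect matching -/

theorem mainTheorem1 {Ω : Type*} [MeasurableSpace Ω] (P : Measure Ω) [IsProbabilityMeasure P]
    (r : ℕ) (hr : 1 ≤ r) (p : ℕ → ℕ)
    (M : ∀ n, IndirectMatching.FactorModel Ω r n (p n))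
    (A : Set (EuclideanSpace ℝ (Fin r)))
    (hmean : IndirectMatching.ErrorsCentered P M)
    (hlatent : IndirectMatching.RegularLatent P A M)
    (hfunctions : IndirectMatching.RegularFunctions P A M)
    (herrors : IndirectMatching.RegularErrors P M)
    (R : ∀ n, Finset (Fin (p n)))
    (ρ : ∀ n, IndirectMatching.DistanceRule n (R n))
    (ρ₀ ςlow ςup : ℝ) (hρ₀ : 0 ≤ ρ₀) (hςlow : 0 < ςlow) (hςup : 0 < ςup)
    (a : ℕ → ℝ) (ha_pos : ∀ n, 0 < a n) (ha : Tendsto a atTop (𝓝 0))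
    (hdenoise : IndirectMatching.Denoises P M R ρ ρ₀ a)
    (hupper : IndirectMatching.UpperPower P M R ρ ςup)
    (hlower : IndirectMatching.LowerPower P M R ρ ςlow)
    (K : ℕ → ℕ) (hK : ∀ n, 1 ≤ n → 1 ≤ K n ∧ K n ≤ n)
    (hK_large : Tendsto (fun n : ℕ => Real.log ((n : ℝ) / K n) / K n) atTop (𝓝 0))
    (hK_small : Tendsto (fun n : ℕ => (K n : ℝ) * Real.log n / n) atTop (𝓝 0))
    (j : ∀ n, Ω → Fin n → Fin (K n) → Fin n)
    (hj : ∀ n ω, IndirectMatching.IsNearestNeighbors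
      (ρ n (IndirectMatching.rows (R n) ((M n).X ω))) (j n ω)) :
    IndirectMatching.IsBigOP P
      (fun n ω => ⨆ i : Fin n, ⨆ k : Fin (K n), ‖(M n).α i ω - (M n).α (j n ω i k) ω‖)
      (fun n => ((K n : ℝ) / n) ^ (ςup / (ςlow * r)) + a n ^ (1 / ςlow)) := by
  obtain ⟨L, hL, hball⟩ :=
    IndirectMatching.RegularLatent.exists_eventually_ncard_lt_le hr hlatent hK hK_large hK_small
  refine IndirectMatching.isBigOP_of_exists_eventually_le fun δ hδ => ?_
  have hδ4 : 0 < δ / 4 := ENNReal.div_pos hδ.ne' (by simp)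
  obtain ⟨e₁, he₁, h₁⟩ := hdenoise.exists_eventually_le hδ4
  obtain ⟨e₂, he₂, h₂⟩ := hupper.exists_eventually_le hδ4
  obtain ⟨e₃, he₃, h₃⟩ := hlower.exists_eventually_le hδ4
  have hr0 : (0 : ℝ) < r := by exact_mod_cast hr
  -- With y the claimed rate, both κ^(ςup/r) and a_n are at most y^ςlow, so the deterministic bound
  -- becomes G · y^ςlow.
  set G : ℝ := e₃ * (e₂ * L ^ ςup + 2 * e₁) with hG
  have hG0 : 0 < G := by positivity
  have h4 : ∀ᶠ n : ℕ in atTop, ENNReal.ofReal (1 / n) ≤ δ / 4 := by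
    have := ENNReal.tendsto_ofReal tendsto_one_div_atTop_nhds_zero_nat
    rw [ENNReal.ofReal_zero] at this
    exact ENNReal.tendsto_nhds_zero.1 this _ hδ4
  -- The extra 1 makes the inequality strict, as the bad event includes equality.
  refine ⟨G ^ (1 / ςlow) + 1, ?_⟩
  filter_upwards [h₁, h₂, h₃, hball, h4] with n h₁ h₂ h₃ hball h4
  have hsplit : δ / 4 + δ / 4 + δ / 4 + δ / 4 = δ := by
    rw [← ENNReal.add_div, ← ENNReal.add_div, ← ENNReal.add_div,
      show δ + δ + δ + δ = 4 * δ by ring, mul_div_assoc]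
    exact ENNReal.mul_div_cancel (by simp) (by simp)
  refine le_trans ?_ ((add_le_add (add_le_add (add_le_add h₁ h₂) h₃) (hball.trans h4)).trans_eq
    hsplit)
  -- Four bad events, each of outer probability at most δ/4: denoising, upper power, lower power and
  -- ball counts.
  refine le_trans (measure_mono ?_) ((measure_union_le _ _).trans (add_le_add_left
    ((measure_union_le _ _).trans (add_le_add_left (measure_union_le _ _) _)) _))
  intro ω hω
  by_contra hgood
  simp only [Set.mem_union, not_or, Set.mem_ofPred_eq, not_le, not_exists, not_lt] at hgood hω
  obtain ⟨⟨⟨hd, hu⟩, hl⟩, hb⟩ := hgood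
  have han := ha_pos n
  set y : ℝ := ((K n : ℝ) / n) ^ (ςup / (ςlow * r)) + a n ^ (1 / ςlow) with hy
  have hy1 : 0 ≤ ((K n : ℝ) / n) ^ (ςup / (ςlow * r)) := by positivity
  have hy2 : 0 < a n ^ (1 / ςlow) := by positivity
  have hy0 : 0 < y := by positivity
  have hay : a n ≤ y ^ ςlow := by
    calc a n = (a n ^ (1 / ςlow)) ^ ςlow := by
          rw [← Real.rpow_mul han.le, one_div_mul_cancel hςlow.ne', Real.rpow_one]
      _ ≤ _ := Real.rpow_le_rpow hy2.le (by linarith) hςlow.le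
  have hκy : (((K n : ℝ) / n) ^ (1 / (r : ℝ))) ^ ςup ≤ y ^ ςlow := by
    calc _ = (((K n : ℝ) / n) ^ (ςup / (ςlow * r))) ^ ςlow := by
          rw [← Real.rpow_mul (by positivity), ← Real.rpow_mul (by positivity)]
          congr 1
          field_simp
      _ ≤ _ := Real.rpow_le_rpow hy1 (by linarith) hςlow.le
  have hdX : ∀ i ℓ, i ≠ ℓ →
      |ρ n (IndirectMatching.rows (R n) ((M n).X ω)) i ℓ -
        ρ n (IndirectMatching.rows (R n) ((M n).H ω)) i ℓ - ρ₀| ≤ e₁ * a n := by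
    intro i ℓ hiℓ
    rw [abs_div, abs_of_pos han, div_lt_iff₀ han] at hd
    exact ((le_ciSup (f := fun q : {q : Fin n × Fin n // q.1 ≠ q.2} =>
      |ρ n (IndirectMatching.rows (R n) ((M n).X ω)) q.1.1 q.1.2 -
        ρ n (IndirectMatching.rows (R n) ((M n).H ω)) q.1.1 q.1.2 - ρ₀|)
      (Set.finite_range _).bddAbove ⟨(i, ℓ), hiℓ⟩).trans (le_abs_self _)).trans hd.le
  have hup : ∀ i ℓ, (M n).α i ω ≠ (M n).α ℓ ω →
      ρ n (IndirectMatching.rows (R n) ((M n).H ω)) i ℓ ≤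
        e₂ * ‖(M n).α i ω - (M n).α ℓ ω‖ ^ ςup := by
    intro i ℓ hiℓ
    rw [div_one] at hu
    rw [← div_le_iff₀ (Real.rpow_pos_of_pos (norm_pos_iff.2 (sub_ne_zero.2 hiℓ)) _)]
    exact ((le_ciSup (f := fun q : {q : Fin n × Fin n // (M n).α q.1 ω ≠ (M n).α q.2 ω} =>
      ρ n (IndirectMatching.rows (R n) ((M n).H ω)) q.1.1 q.1.2 /
        ‖(M n).α q.1.1 ω - (M n).α q.1.2 ω‖ ^ ςup)
      (Set.finite_range _).bddAbove ⟨(i, ℓ), hiℓ⟩).trans (le_abs_self _)).trans hu.le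
  have hlow : ∀ i ℓ, (M n).α i ω ≠ (M n).α ℓ ω →
      ‖(M n).α i ω - (M n).α ℓ ω‖ ^ ςlow ≤
        e₃ * ρ n (IndirectMatching.rows (R n) ((M n).H ω)) i ℓ := by
    intro i ℓ hiℓ
    have h5 := hl.trans_le (mul_le_mul_of_nonneg_left
      (ciInf_le (f := fun q : {q : Fin n × Fin n // (M n).α q.1 ω ≠ (M n).α q.2 ω} =>
      ρ n (IndirectMatching.rows (R n) ((M n).H ω)) q.1.1 q.1.2 /
        ‖(M n).α q.1.1 ω - (M n).α q.1.2 ω‖ ^ ςlow)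
      (Set.finite_range _).bddBelow ⟨(i, ℓ), hiℓ⟩) he₃.le)
    rw [← mul_div_assoc, lt_div_iff₀
      (Real.rpow_pos_of_pos (norm_pos_iff.2 (sub_ne_zero.2 hiℓ)) _), one_mul] at h5
    exact h5.le
  have hmain : ∀ i k, ‖(M n).α i ω - (M n).α (j n ω i k) ω‖ ≤ G ^ (1 / ςlow) * y := by
    intro i k
    have h6 := (hj n ω).norm_rpow_le he₂.le he₃.le hςlow hςup hdX hup hlow hb (by positivity)
      (by positivity) i k
    have h7 : e₃ * (e₂ * (L * ((K n : ℝ) / n) ^ (1 / (r : ℝ))) ^ ςup + 2 * (e₁ * a n)) ≤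
        (G ^ (1 / ςlow) * y) ^ ςlow := by
      rw [Real.mul_rpow (by positivity) hy0.le, ← Real.rpow_mul hG0.le,
        one_div_mul_cancel hςlow.ne', Real.rpow_one, Real.mul_rpow hL.le (by positivity), hG]
      calc _ ≤ e₃ * (e₂ * (L ^ ςup * y ^ ςlow) + 2 * (e₁ * y ^ ςlow)) := by gcongr
        _ = _ := by ring
    exact (Real.rpow_le_rpow_iff (norm_nonneg _) (by positivity) hςlow).1 (h6.trans h7)
  have hsup : (⨆ i : Fin n, ⨆ k : Fin (K n), ‖(M n).α i ω - (M n).α (j n ω i k) ω‖) ≤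
      G ^ (1 / ςlow) * y :=
    -- An empty real supremum is 0, hence the nonnegativity side goals.
    Real.iSup_le (fun i => Real.iSup_le (fun k => hmain i k) (by positivity)) (by positivity)
  have hsup0 : 0 ≤ ⨆ i : Fin n, ⨆ k : Fin (K n), ‖(M n).α i ω - (M n).α (j n ω i k) ω‖ :=
    Real.iSup_nonneg fun i => Real.iSup_nonneg fun k => norm_nonneg _
  rw [abs_of_nonneg (div_nonneg hsup0 hy0.le), le_div_iff₀ hy0] at hω
  linarith
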